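/- Let $p$ be a prime, let $K$ be a field of characteristic $p$, and let $L/K$ be a finite separable field extension of degree $[L:K]=p^m$ for some integer $m\ge 0$. For a $K$-Hopf algebra $H$ (with comultiplication $\Delta$ and counit $\epsilon$) acting $K$-linearly on $L$, say that $L/K$ is $H$-Galois if $L$ is an $H$-module algebra (that is, $L$ is a left $H$-module, $h\cdot 1=\epsilon(h)1$, and $h\cdot(xy)=\sum (h_{(1)}\cdot x)(h_{(2)}\cdot y)$ where $\Delta(h)=\sum h_{(1)}\otimes h_{(2)}$) and the $L$-linear map $L\otimes_K H\to \mathrm{End}_K(L)$, $l\otimes h\mapsto (x\mapsto l\,(h\cdot x))$, is bijective. A Hopf–Galois structure on $L/K$ is such an $H$ together with its action. An element $\rho\in L$ is a normal basis generator for $L/K$ with respect to $H$ if it freely generates $L$ as an $H$-module, that is, if the map $H\to L$, $h\mapsto h\cdot\rho$, is bijective. If $L/K$ is $H$-Galois, then for every $\rho\in L$, $$\rho \text{ is a normal basis generator for } L/K \text{ with respect to } H \iff \mathrm{Tr}_{L/K}(\rho)\neq 0 .$$ In particular, the set of normal basis generators for $L/K$ is the same for all Hopf–Galois structures on $L/K$.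 -/

import Mathlib

open scoped TensorProduct

/-- `L` is an `H`-module algebra over the `K`-bialgebra `H`, i.e. `h(1) = ε(h)` and
`h(xy) = ∑ h₍₁₎(x) h₍₂₎(y)` where `Δ(h) = ∑ h₍₁₎ ⊗ h₍₂₎`. Here `IsScalarTower K H L` says that the
action of `H` on `L` extends that of `K`. -/
structure IsModuleAlgebra (K H L : Type*) [Field K] [Ring H] [Bialgebra K H] [Field L] [Algebra K L]
    [Module H L] [IsScalarTower K H L] : Prop where
  smul_one : ∀ h : H, h • (1 : L) = algebraMap K L (Coalgebra.counit (R := K) h)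
  smul_mul : ∀ (h : H) (x y : L), h • (x * y) =
    LinearMap.mul' K L
      (TensorProduct.map
        ((LinearMap.toSpanSingleton H L x).restrictScalars K)
        ((LinearMap.toSpanSingleton H L y).restrictScalars K)
        (Coalgebra.comul (R := K) h))

/-- The `L`-linear extension `L ⊗[K] H → End_K(L)`, `l ⊗ h ↦ (x ↦ l * h(x))`, of the map
`H → End_K(L)` that gives the action of `H` on `L`. -/
noncomputable def hopfGaloisMap (K H L : Type*) [Field K] [Ring H] [Algebra K H] [Field L]
    [Algebra K L] [Module H L] [IsScalarTower K H L] :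
    L ⊗[K] H →ₗ[L] Module.End K L :=
  LinearMap.liftBaseChange L (Algebra.lsmul K K L : H →ₐ[K] Module.End K L).toLinearMap

/-- `L/K` is `H`-Galois: `L` is an `H`-module algebra and the `L`-linear map
`L ⊗[K] H → End_K(L)` is an isomorphism. -/
structure IsHopfGalois (K H L : Type*) [Field K] [Ring H] [HopfAlgebra K H] [Field L] [Algebra K L]
    [Module H L] [IsScalarTower K H L] : Prop extends IsModuleAlgebra K H L where
  bijective : Function.Bijective (hopfGaloisMap K H L)

/-- `ρ` is a free generator of the `H`-module `L`, i.e. `h ↦ h(ρ)` is an isomorphism of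
`H`-modules from `H` to `L`. -/
def IsNormalBasisGenerator (H : Type*) {L : Type*} [Ring H] [AddCommGroup L] [Module H L]
    (ρ : L) : Prop :=
  Function.Bijective (LinearMap.toSpanSingleton H L ρ)

open Module

/-! Extend scalars to an algebraic closure `E` of `L`. Composing the action with an embedding `σ`
identifies `E ⊗ H` with `Hom_K(L, E)`, and group-like elements with embeddings
(`IsHopfGalois.groupLikeEquiv`). By separability there are `[L:K] = dim H` of these, so `E ⊗ H` is
the group algebra of a group `G` of order `p ^ m`. The annihilator of `1 ⊗ ρ` is a left ideal. If
nonzero, it contains a nonzero `G`-fixed vector, since `G` is a `p`-group in characteristic `p`;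
such a vector is a multiple of `T = ∑ g`. As `T` sends `ρ` to its trace, the annihilator vanishes
exactly when the trace does not. -/

/-- A `p`-group acting linearly on a vector space over a finite field of characteristic `p` has a
nonzero fixed vector in the span of the orbit of any nonzero vector. -/
theorem IsPGroup.exists_ne_zero_mem_span_orbit_forall_smul_eq {p : ℕ} [Fact p.Prime] {G : Type*}
    [Group G] [Finite G] (hG : IsPGroup p G) (F : Type*) [Field F] [Finite F] [CharP F p]
    {V : Type*} [AddCommGroup V] [Module F V] [DistribMulAction G V] [SMulCommClass G F V]
    {v : V} (hv : v ≠ 0) :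
    ∃ w ∈ Submodule.span F (MulAction.orbit G v), w ≠ 0 ∧ ∀ g : G, g • w = w := by
  let S := Submodule.span F (MulAction.orbit G v)
  have hvS : v ∈ S := Submodule.subset_span (MulAction.mem_orbit_self v)
  have hS (g : G) : S ≤ S.comap (DistribSMul.toLinearMap F V g) := by
    refine Submodule.span_le.2 ?_
    rintro _ ⟨h, rfl⟩
    exact Submodule.subset_span ⟨g * h, mul_smul g h v⟩
  have : Module.Finite F S :=
    Module.Finite.span_of_finite F (Set.finite_range fun g : G => g • v)
  have : Finite S := Module.finite_of_finite F
  have : Nontrivial S := ⟨⟨v, hvS⟩, 0, fun h => hv (congrArg Subtype.val h)⟩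
  let _ : MulAction G S :=
    { smul := fun g x => ⟨g • (x : V), hS g x.2⟩
      one_smul := fun x => Subtype.ext (one_smul G (x : V))
      mul_smul := fun g h x => Subtype.ext (mul_smul g h (x : V)) }
  -- The number of fixed points is congruent to `|S|`, hence to 0, mod `p`; so 0 is not the only
  -- one.
  have hcard : p ∣ Nat.card S := by
    have hF : p ∣ Nat.card F := (CharP.cast_eq_zero_iff F p _).1 (by
      have := Fintype.ofFinite F
      rw [Nat.card_eq_fintype_card, Nat.cast_card_eq_zero])
    rw [Module.natCard_eq_pow_finrank (K := F)]
    exact dvd_pow hF Module.finrank_pos.ne'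
  have h0 : (0 : S) ∈ MulAction.fixedPoints G S := fun g => Subtype.ext (smul_zero g)
  obtain ⟨w, hw, hw0⟩ := hG.exists_fixed_point_of_prime_dvd_card_of_fixed_point S hcard h0
  exact ⟨w, w.2, fun h => hw0 (Subtype.ext h.symm), fun g => congrArg Subtype.val (hw g)⟩

/-- A `p`-group acting linearly on a vector space over a field of characteristic `p` has a
nonzero fixed vector in every nonzero stable subspace. -/
theorem IsPGroup.exists_ne_zero_mem_forall_smul_eq {p : ℕ} [Fact p.Prime] {G : Type*} [Group G]
    [Finite G] (hG : IsPGroup p G) {E : Type*} [Field E] [CharP E p] {V : Type*} [AddCommGroup V]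
    [Module E V] [DistribMulAction G V] [SMulCommClass G E V]
    (J : Submodule E V) (hJ : ∀ (g : G), ∀ v ∈ J, g • v ∈ J) {v : V} (hvJ : v ∈ J) (hv : v ≠ 0) :
    ∃ w ∈ J, w ≠ 0 ∧ ∀ g : G, g • w = w := by
  -- `E` may be infinite; orbit counting needs the prime field.
  let φ := ZMod.castHom (dvd_refl p) E
  let F := φ.fieldRange
  have : Finite F := inferInstanceAs (Finite (Set.range φ))
  have : SMulCommClass G F V := ⟨fun g c x => smul_comm g (c : E) x⟩
  obtain ⟨w, hw, hw0, hwG⟩ := hG.exists_ne_zero_mem_span_orbit_forall_smul_eq F hv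
  have hle : Submodule.span F (MulAction.orbit G v) ≤ J.restrictScalars F := by
    refine Submodule.span_le.2 ?_
    rintro _ ⟨h, rfl⟩
    exact hJ h v hvJ
  exact ⟨w, hle hw, hw0, hwG⟩

section Coefficients

variable {K H L E : Type*} [Field K] [Ring H] [Field L] [Algebra K L] [Module H L]
  [Field E] [Algebra K E]

section Algebra

variable [Algebra K H] [IsScalarTower K H L]

/-- The matrix coefficients of the action of `H` on `L` with respect to a functional `f` on `L`
with values in `E`: the `E`-linear map `e ⊗ h ↦ (x ↦ e * f (h x))`. -/
noncomputable def matrixCoeff (f : L →ₗ[K] E) : E ⊗[K] H →ₗ[E] (L →ₗ[K] E) :=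
  LinearMap.liftBaseChange E
    (LinearMap.compRight K f ∘ₗ (Algebra.lsmul K K L : H →ₐ[K] Module.End K L).toLinearMap)

@[simp]
theorem matrixCoeff_tmul (f : L →ₗ[K] E) (e : E) (h : H) (x : L) :
    matrixCoeff f (e ⊗ₜ[K] h) x = e * f (h • x) := by
  simp [matrixCoeff]

/-- Functionals thus form a right `E ⊗ H`-module, with `f · a = matrixCoeff f a`. -/
theorem matrixCoeff_mul (f : L →ₗ[K] E) (a b : E ⊗[K] H) :
    matrixCoeff f (a * b) = matrixCoeff (matrixCoeff f a) b := by
  ext x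
  induction b with
  | zero => simp
  | add b c hb hc => simp [mul_add, hb, hc]
  | tmul e' h' =>
    induction a with
    | zero => simp
    | add a c ha hc => simp [add_mul, ha, hc, mul_add]
    | tmul e h =>
      simp [Algebra.TensorProduct.tmul_mul_tmul, mul_smul]
      ring

/-- The right side says that `a` kills `1 ⊗ x` in `E ⊗ L`, whose coordinates are themselves given by
functionals `f`. -/
theorem forall_matrixCoeff_apply_eq_zero_iff [FiniteDimensional K L] (a : E ⊗[K] H) (x : L) :
    (∀ f : L →ₗ[K] E, matrixCoeff f a x = 0) ↔
      LinearMap.lTensor E ((LinearMap.toSpanSingleton H L x).restrictScalars K) a = 0 := by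
  have key : ∀ f : L →ₗ[K] E, matrixCoeff f a x = LinearMap.liftBaseChange E f
      (LinearMap.lTensor E ((LinearMap.toSpanSingleton H L x).restrictScalars K) a) := by
    intro f
    induction a with
    | zero => simp
    | add a c ha hc => simp [ha, hc]
    | tmul e h => simp
  simp_rw [key]
  refine ⟨fun h => ?_, fun h f => by rw [h, map_zero]⟩
  let b := (Module.finBasis K L).baseChange E
  refine b.ext_elem fun i => ?_
  have hi : b.coord i = LinearMap.liftBaseChange E
      (Algebra.linearMap K E ∘ₗ (Module.finBasis K L).coord i) := by
    refine TensorProduct.AlgebraTensorModule.ext fun e y => ?_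
    simp [b, Algebra.smul_def, mul_comm]
  simpa using (LinearMap.congr_fun hi _).trans (h _)

theorem injective_toSpanSingleton_iff_forall_matrixCoeff [FiniteDimensional K L] (x : L) :
    Function.Injective (LinearMap.toSpanSingleton H L x) ↔
      ∀ a : E ⊗[K] H, (∀ f : L →ₗ[K] E, matrixCoeff f a x = 0) → a = 0 := by
  have := Module.FaithfullyFlat.lTensor_injective_iff_injective (R := K) E
    ((LinearMap.toSpanSingleton H L x).restrictScalars K)
  rw [LinearMap.coe_restrictScalars] at this
  rw [← this, injective_iff_map_eq_zero]
  simp_rw [forall_matrixCoeff_apply_eq_zero_iff]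

end Algebra

section HopfGalois

variable [HopfAlgebra K H] [IsScalarTower K H L]

theorem IsHopfGalois.finite [FiniteDimensional K L] (hG : IsHopfGalois K H L) :
    Module.Finite K H := by
  have e := LinearEquiv.ofBijective _ hG.bijective
  have : Module.Finite L (L ⊗[K] H) := Module.Finite.equiv e.symm
  exact Module.Finite.of_finite_tensorProduct_of_faithfullyFlat L

theorem IsHopfGalois.finrank_eq [FiniteDimensional K L] (hG : IsHopfGalois K H L) :
    finrank K H = finrank K L := by
  have e := LinearEquiv.ofBijective _ hG.bijective
  have := e.finrank_eq
  rwa [Module.finrank_baseChange, Module.finrank_linearMap, finrank_self, mul_one] at this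

theorem IsHopfGalois.bijective_matrixCoeff [FiniteDimensional K L] (hG : IsHopfGalois K H L)
    (σ : L →ₐ[K] E) :
    Function.Bijective (matrixCoeff (H := H) σ.toLinearMap) := by
  have := hG.finite
  have hsurj : Function.Surjective (matrixCoeff (H := H) σ.toLinearMap) := by
    have hmem (T : Module.End K L) :
        σ.toLinearMap ∘ₗ T ∈ LinearMap.range (matrixCoeff (H := H) σ.toLinearMap) := by
      obtain ⟨t, rfl⟩ := hG.bijective.2 T
      induction t with
      | zero => simp
      | add a c ha hc =>
        rw [map_add, LinearMap.comp_add]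
        exact add_mem ha hc
      | tmul l h =>
        refine ⟨σ l ⊗ₜ h, ?_⟩
        ext x
        simp [hopfGaloisMap]
    intro f
    let b := Module.finBasis K L
    -- The maps `σ ∘ T` already span over `E`: take `T` to be a coordinate of `b` followed by the
    -- inclusion of `K` in `L`.
    have hf : f = ∑ i, f (b i) • (σ.toLinearMap ∘ₗ (Algebra.linearMap K L ∘ₗ b.coord i)) := by
      refine b.ext fun j => ?_
      simp [Finsupp.single_apply]
    rw [← LinearMap.mem_range, hf]
    exact Submodule.sum_mem _ fun i _ => Submodule.smul_mem _ _ (hmem _)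
  have hdim : finrank E (E ⊗[K] H) = finrank E (L →ₗ[K] E) := by
    rw [Module.finrank_baseChange, Module.finrank_linearMap, finrank_self, mul_one, hG.finrank_eq]
  exact ⟨(LinearMap.injective_iff_surjective_of_finrank_eq_finrank hdim).2 hsurj, hsurj⟩

theorem IsModuleAlgebra.matrixCoeff_apply_one (hG : IsModuleAlgebra K H L) (σ : L →ₐ[K] E)
    (a : E ⊗[K] H) :
    matrixCoeff σ.toLinearMap a 1 = Coalgebra.counit (R := E) a := by
  induction a with
  | zero => simp
  | add a c ha hc => simp [ha, hc]
  | tmul e h => simp [hG.smul_one, Algebra.smul_def, mul_comm]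

theorem IsModuleAlgebra.matrixCoeff_apply_mul (hG : IsModuleAlgebra K H L) (σ : L →ₐ[K] E)
    (a : E ⊗[K] H) (x y : L) :
    matrixCoeff σ.toLinearMap a (x * y) = LinearMap.mul' E E
      (TensorProduct.map
        (LinearMap.applyₗ' E x ∘ₗ matrixCoeff σ.toLinearMap)
        (LinearMap.applyₗ' E y ∘ₗ matrixCoeff σ.toLinearMap)
        (Coalgebra.comul (R := E) a)) := by
  induction a with
  | zero => simp
  | add a c ha hc => simp only [map_add, LinearMap.add_apply, ha, hc]
  | tmul e h =>
    rw [matrixCoeff_tmul, hG.smul_mul, TensorProduct.comul_tmul]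
    generalize Coalgebra.comul (R := K) h = t
    induction t with
    | zero => simp
    | add a c ha hc => simp only [map_add, mul_add, TensorProduct.tmul_add, ha, hc]
    | tmul u v =>
      simp
      ring

/-- For an `H`-Galois extension, an element of the scalar extension of `H` whose matrix
coefficients form an algebra homomorphism is group-like. -/
theorem IsHopfGalois.isGroupLikeElem_of_matrixCoeff_eq [FiniteDimensional K L]
    (hG : IsHopfGalois K H L) (σ τ : L →ₐ[K] E) {a : E ⊗[K] H}
    (ha : matrixCoeff σ.toLinearMap a = τ.toLinearMap) : IsGroupLikeElem E a := by
  refine ⟨?_, ?_⟩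
  · rw [← hG.matrixCoeff_apply_one σ, ha]
    simp
  · let b := Module.finBasis K L
    -- In this basis the coordinates of `u` are its matrix coefficients at the `b i`, so `Δ(a) = a ⊗
    -- a` reduces to multiplicativity of `τ` on products `b i * b j`.
    let B : Basis _ E (E ⊗[K] H) := Basis.ofEquivFun
      ((LinearEquiv.ofBijective _ (hG.bijective_matrixCoeff σ)).trans (b.constr E).symm)
    have hB (i) (u : E ⊗[K] H) : B.repr u i = matrixCoeff σ.toLinearMap u (b i) := by
      simp [B, Basis.constr]
    refine (B.tensorProduct B).ext_elem fun ⟨i, j⟩ => ?_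
    have hBB (t : (E ⊗[K] H) ⊗[E] (E ⊗[K] H)) : (B.tensorProduct B).repr t (i, j) =
        LinearMap.mul' E E (TensorProduct.map
          (LinearMap.applyₗ' E (b i) ∘ₗ matrixCoeff σ.toLinearMap)
          (LinearMap.applyₗ' E (b j) ∘ₗ matrixCoeff σ.toLinearMap) t) := by
      induction t with
      | zero => simp
      | add s t hs ht => simp [hs, ht]
      | tmul u v => simp [hB, mul_comm]
    rw [hBB, hBB, ← hG.matrixCoeff_apply_mul, ha]
    simp [ha]

/-- For an `H`-Galois extension `L/K`, the group-like elements of the scalar extension of `H` to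
`E` correspond to the `K`-embeddings of `L` into `E`. -/
noncomputable def IsHopfGalois.groupLikeEquiv [FiniteDimensional K L]
    (hG : IsHopfGalois K H L) (σ : L →ₐ[K] E) :
    GroupLike E (E ⊗[K] H) ≃ (L →ₐ[K] E) :=
  Equiv.ofBijective
    (fun g => AlgHom.ofLinearMap (matrixCoeff σ.toLinearMap g.val)
      (by rw [hG.matrixCoeff_apply_one, g.2.counit_eq_one])
      (fun x y => by rw [hG.matrixCoeff_apply_mul, g.2.comul_eq_tmul_self]; simp))
    ⟨fun g h hgh => GroupLike.val_injective <| (hG.bijective_matrixCoeff σ).1 <|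
        LinearMap.ext fun x => DFunLike.congr_fun hgh x,
      fun τ => by
        obtain ⟨a, ha⟩ := (hG.bijective_matrixCoeff (H := H) σ).2 τ.toLinearMap
        exact ⟨⟨a, hG.isGroupLikeElem_of_matrixCoeff_eq σ τ ha⟩,
          AlgHom.ext fun x => LinearMap.congr_fun ha x⟩⟩

theorem IsHopfGalois.groupLikeEquiv_apply [FiniteDimensional K L]
    (hG : IsHopfGalois K H L) (σ : L →ₐ[K] E) (g : GroupLike E (E ⊗[K] H)) (x : L) :
    hG.groupLikeEquiv σ g x = matrixCoeff σ.toLinearMap g.val x :=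
  rfl

end HopfGalois

end Coefficients

section Trace

variable {K H L : Type*} [Field K] [Field L] [Algebra K L]
    [FiniteDimensional K L] [Ring H] [HopfAlgebra K H]
    [Module H L] [IsScalarTower K H L]

theorem IsHopfGalois.isNormalBasisGenerator_iff_injective (hG : IsHopfGalois K H L) (ρ : L) :
    IsNormalBasisGenerator H ρ ↔ Function.Injective (LinearMap.toSpanSingleton H L ρ) := by
  have := hG.finite
  have := LinearMap.injective_iff_surjective_of_finrank_eq_finrank hG.finrank_eq
    (f := (LinearMap.toSpanSingleton H L ρ).restrictScalars K)
  exact ⟨fun h => h.1, fun h => ⟨h, this.1 h⟩⟩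

/-- An extension of degree a power of the characteristic that is `H`-Galois has as normal basis
generators with respect to `H` precisely the elements of nonzero trace. -/
theorem IsHopfGalois.isNormalBasisGenerator_iff_trace_ne_zero [Algebra.IsSeparable K L]
    (p : ℕ) [Fact p.Prime] [CharP K p] (m : ℕ) (hdeg : Module.finrank K L = p ^ m)
    (hG : IsHopfGalois K H L) (ρ : L) :
    IsNormalBasisGenerator H ρ ↔ Algebra.trace K L ρ ≠ 0 := by
  classical
  let E := AlgebraicClosure L
  let σ : L →ₐ[K] E := IsScalarTower.toAlgHom K L E
  let A := E ⊗[K] H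
  let G := GroupLike E A
  have := hG.finite
  let eG : G ≃ (L →ₐ[K] E) := hG.groupLikeEquiv σ
  let _ : Fintype G := Fintype.ofEquiv _ eG.symm
  have hcard : Fintype.card G = finrank K L := by
    rw [Fintype.card_congr eG, AlgHom.card]
  have hpG : IsPGroup p G := IsPGroup.of_card (n := m) (by
    rw [Nat.card_eq_fintype_card, hcard, hdeg])
  let B : Basis G E A := basisOfLinearIndependentOfCardEqFinrank
    (linearIndep_groupLikeVal (R := E) (A := A))
    (by rw [hcard, Module.finrank_baseChange, hG.finrank_eq])
  have hB (g : G) : B g = g.val := by exact congrFun (coe_basisOfLinearIndependentOfCardEqFinrank _ _) g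
  let T : A := ∑ g : G, g.val
  have hgT (g : G) : g.val * T = T := by
    rw [Finset.mul_sum]
    exact Equiv.sum_comp (Equiv.mulLeft g) GroupLike.val
  have hT0 : T ≠ 0 := by
    intro h
    have := Fintype.linearIndependent_iff.1 (linearIndep_groupLikeVal (R := E) (A := A))
      (fun _ => 1) (by simpa using h) 1
    exact one_ne_zero this
  have hTtrace : matrixCoeff σ.toLinearMap T ρ = algebraMap K E (Algebra.trace K L ρ) := by
    rw [trace_eq_sum_embeddings E, map_sum, LinearMap.sum_apply]
    exact Equiv.sum_comp eG (fun τ => τ ρ)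
  rw [hG.isNormalBasisGenerator_iff_injective,
    injective_toSpanSingleton_iff_forall_matrixCoeff (K := K) (E := E)]
  constructor
  · intro h htr
    refine hT0 (h T fun f => ?_)
    -- Every functional is `σ · a`, and `a * T` is a scalar multiple of `T`, so only the trace of
    -- `ρ` matters.
    obtain ⟨a, rfl⟩ := (hG.bijective_matrixCoeff σ).2 f
    rw [← matrixCoeff_mul, ← B.sum_repr a, Finset.sum_mul]
    simp [hB, hgT, hTtrace, htr]
  · intro htr a ha
    by_contra ha0
    let _ : DistribMulAction G A := DistribMulAction.compHom A (GroupLike.valMonoidHom E A)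
    have hsmul (g : G) (x : A) : g • x = g.val * x := rfl
    have : SMulCommClass G E A := ⟨fun g c x => mul_smul_comm c g.val x⟩
    have : CharP E p := charP_of_injective_algebraMap (algebraMap K E).injective p
    let J : Submodule E A :=
      { carrier := {a | ∀ f : L →ₗ[K] E, matrixCoeff f a ρ = 0}
        zero_mem' := fun f => by simp
        add_mem' := fun ha hb f => by simp [ha f, hb f]
        smul_mem' := fun c a ha f => by simp [ha f] }
    obtain ⟨w, hwJ, hw0, hw⟩ := hpG.exists_ne_zero_mem_forall_smul_eq J
      (fun g v hv f => by rw [hsmul, matrixCoeff_mul]; exact hv _) ha ha0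
    -- `G` permutes the basis `B` simply transitively, so a fixed vector has constant coordinates.
    have hrepr (g : G) : B.repr w g = B.repr w 1 := by
      have hcoord : B.coord g ∘ₗ LinearMap.mulLeft E g.val = B.coord 1 := by
        refine B.ext fun h => ?_
        have hgh : g.val * B h = B (g * h) := by rw [hB, hB, GroupLike.val_mul]
        simp [hgh, Finsupp.single_apply]
      calc B.repr w g = B.repr (g.val * w) g := by rw [← hsmul, hw]
        _ = B.repr w 1 := LinearMap.congr_fun hcoord w
    have hwT : w = B.repr w 1 • T := by
      conv_lhs => rw [← B.sum_repr w]
      simp_rw [hrepr, hB, T, Finset.smul_sum]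
    have hc : B.repr w 1 ≠ 0 := fun h => hw0 (by rw [hwT, h, zero_smul])
    have := hwJ σ.toLinearMap
    rw [hwT, map_smul, LinearMap.smul_apply, hTtrace, smul_eq_mul] at this
    exact htr ((map_eq_zero _).1 ((mul_eq_zero.1 this).resolve_left hc))

end Trace

theorem mainTheorem2 {K L : Type*} [Field K] [Field L] [Algebra K L]
    [FiniteDimensional K L] [Algebra.IsSeparable K L]
    (p : ℕ) [Fact p.Prime] [CharP K p] (m : ℕ) (hdeg : Module.finrank K L = p ^ m) :
    (∀ (H : Type*) [Ring H] [HopfAlgebra K H] [Module H L] [IsScalarTower K H L],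
      IsHopfGalois K H L →
        ∀ ρ : L, IsNormalBasisGenerator H ρ ↔ Algebra.trace K L ρ ≠ 0) ∧
    (∀ (H : Type*) [Ring H] [HopfAlgebra K H] [Module H L] [IsScalarTower K H L]
      (H' : Type*) [Ring H'] [HopfAlgebra K H'] [Module H' L] [IsScalarTower K H' L],
      IsHopfGalois K H L → IsHopfGalois K H' L →
        {ρ : L | IsNormalBasisGenerator H ρ} = {ρ : L | IsNormalBasisGenerator H' ρ}) := by
  refine ⟨fun H _ _ _ _ hG ρ => hG.isNormalBasisGenerator_iff_trace_ne_zero p m hdeg ρ,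
    fun H _ _ _ _ H' _ _ _ _ hG hG' => Set.ext fun ρ => ?_⟩
  exact (hG.isNormalBasisGenerator_iff_trace_ne_zero p m hdeg ρ).trans
    (hG'.isNormalBasisGenerator_iff_trace_ne_zero p m hdeg ρ).symm
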